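/- Let $\mathbb F_q$ be a finite field and let $K\ge 1$, $0\le K'\le K$, $N\ge 1$ be integers. **Model.** A server has $N$ files $F_1,\dots,F_N\in\mathbb F_q^B$ with i.i.d. uniform symbols, so $H(F_{[N]})=\sum_i H(F_i)=NB\log q$. User $j\in[K]$ has local randomness $\tau_j$ (known to the server and to user $j$) and a demand vector $\mathbf d_j\in\mathbb F_q^N$; the files, the $\tau_j$'s and the $\mathbf d_j$'s are all independent. A scheme for file length $B$ consists of the (finite) laws of the $\tau_j$'s, caches $Z_j$ ($j\in[K]$) of at most $MB$ symbols of $\mathbb F_q$, and, for every set $\mathcal I\subseteq[K]$ of $K'$ active users, a signal $X$ of at most $RB$ symbols, such that, whatever the distributions of the demands $\mathbf d_1,\dots,\mathbf d_K$, for all such $\mathcal I$: $$H(Z_j\mid F_{[N]},\tau_j)=0\ (j\in[K]),\qquad H(X\mid \mathbf d_{\mathcal I},F_{[N]},\tau_{[K]})=0,$$ $$H\Big(\sum_{n}d_{j,n}F_n\,\Big|\,X,\mathbf d_j,Z_j\Big)=0\ (j\in\mathcal I),\qquad I(\mathbf d_{\mathcal I\setminus\mathcal B};X,\mathbf d_{\mathcal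 B},Z_{\mathcal B}\mid F_{[N]})=0\ (\emptyset\ne\mathcal B\subseteq\mathcal I).$$ A pair $(M,R)$ is achievable if for every $\varepsilon>0$ and every sufficiently large $B$ there is a scheme with caches of at most $MB$ symbols and a signal of at most $(R+\varepsilon)B$ symbols. **Theorem.** Put $\widetilde N=\frac{q^N-1}{q-1}$ and, for $t\in\{0,1,\dots,K\widetilde N\}$, $$(M_t,R_t)=\left(\frac{tN}{\widetilde N K},\ \frac{\binom{K\widetilde N}{t+1}-\binom{K\widetilde N-\widetilde N}{t+1}}{\binom{K\widetilde N}{t}}\right),\qquad L_t=\binom{K\widetilde N}{t}.$$ 1. For every $M\in[0,N]$ the pair $(M,R(M))$ is achievable, where $R(\cdot)$ is the lower convex envelope of the point $(0,N)$ and the points $(M_t,R_t)$, $0\le t\le K\widetilde N$. 2. For every such $t$ the pair $(M_t,R_t)$ is attained with subpacketization level $L_t$: there is one linear scheme that splits each file into $L_t$ subfiles of equal length $m$ and that satisfies all the constraints for every $m\ge 1$ (so $B=mL_t$), in which each cache consists of $M_tL_t$ linear combinations of subfiles (exactly $M_tB$ symbols), with coefficients depending only on $\tau_j$, and $X$ consists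 of $R_tL_t$ linear combinations of subfiles (exactly $R_tB$ symbols), with coefficients depending only on $(\mathcal I,\mathbf d_{\mathcal I},\tau_{[K]})$, together with a number of control symbols that depend only on $(\mathcal I,\mathbf d_{\mathcal I},\tau_{[K]})$ and whose number does not depend on $m$. -/

import Mathlib

namespace Hotplug

noncomputable section

/-! ### Shannon information of random variables on a finite probability space

The law of the underlying space is a weight function `p : Ω → ℝ` (a point of `stdSimplex ℝ Ω`),
logarithms are natural. -/

section Information

variable {Ω S T U : Type*} [Fintype Ω] [Fintype S] [Fintype T] [Fintype U]

open Classical in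
/-- The probability that `X = s`. -/
def prob (p : Ω → ℝ) (X : Ω → S) (s : S) : ℝ := ∑ ω with X ω = s, p ω

/-- `H(X)`. -/
def entropy (p : Ω → ℝ) (X : Ω → S) : ℝ := ∑ s, Real.negMulLog (prob p X s)

/-- `H(X | Y) = H(X, Y) - H(Y)`. -/
def condEntropy (p : Ω → ℝ) (X : Ω → S) (Y : Ω → T) : ℝ :=
  entropy p (fun ω => (X ω, Y ω)) - entropy p Y

/-- `I(X ; Y | Z) = H(X | Z) - H(X | Y, Z)`. -/
def condMutualInfo (p : Ω → ℝ) (X : Ω → S) (Y : Ω → T) (Z : Ω → U) : ℝ :=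
  condEntropy p X Z - condEntropy p X (fun ω => (Y ω, Z ω))

end Information

/-! ### The hotplug model -/

/-- The outcomes of the basic random variables: the `N` files of `B` symbols each, the local
randomness of each of the `K` users, and a demand vector for each of the `K` users. -/
abbrev Outcome (F : Type*) (K N B : ℕ) (Rand : Fin K → Type) : Type _ :=
  (Fin N → Fin B → F) × ((j : Fin K) → Rand j) × (Fin K → Fin N → F)

/-- The random variables of a caching scheme with `K` users and `N` files of `B` symbols over `F`:
local randomness `τ_j` (with values in a finite set, and with a given law), cache contents `Z_j` of
`cacheLen` symbols, and, for each set `I` of active users, the transmitted signal `X` of `msgLen`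
symbols. -/
structure Scheme (F : Type*) (K N B : ℕ) where
  Rand : Fin K → Type
  [fintypeRand : ∀ j, Fintype (Rand j)]
  randLaw : (j : Fin K) → Rand j → ℝ
  randLaw_mem : ∀ j, randLaw j ∈ stdSimplex ℝ (Rand j)
  cacheLen : ℕ
  msgLen : ℕ
  cache : (j : Fin K) → Outcome F K N B Rand → (Fin cacheLen → F)
  msg : (I : Finset (Fin K)) → Outcome F K N B Rand → (Fin msgLen → F)

attribute [instance] Scheme.fintypeRand

namespace Scheme

variable {F : Type*} [Field F] [Fintype F] {K N B : ℕ} (σ : Scheme F K N B)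

/-- The joint law of files, local randomness and demands: the files are uniform, the users' local
randomness variables have their given laws, the demand of user `j` has law `D j`, and all of these
are independent. -/
def law (D : Fin K → (Fin N → F) → ℝ) (ω : Outcome F K N B σ.Rand) : ℝ :=
  ((Fintype.card F : ℝ) ^ (N * B))⁻¹ * (∏ j, σ.randLaw j (ω.2.1 j)) * ∏ j, D j (ω.2.2 j)

/-- All files. -/
def files (ω : Outcome F K N B σ.Rand) : Fin N → Fin B → F := ω.1

/-- The local randomness of user `j`. -/
def tau (j : Fin K) (ω : Outcome F K N B σ.Rand) : σ.Rand j := ω.2.1 j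

/-- The local randomness of all users. -/
def allTau (ω : Outcome F K N B σ.Rand) : (j : Fin K) → σ.Rand j := ω.2.1

/-- The demand vector of user `j`. -/
def demand (j : Fin K) (ω : Outcome F K N B σ.Rand) : Fin N → F := ω.2.2 j

/-- The demand vectors of the users in `A`. -/
def demands (A : Finset (Fin K)) (ω : Outcome F K N B σ.Rand) : A → Fin N → F :=
  fun j => ω.2.2 j

/-- The caches of the users in `A`. -/
def caches (A : Finset (Fin K)) (ω : Outcome F K N B σ.Rand) : A → Fin σ.cacheLen → F :=
  fun j => σ.cache j ω

/-- The scalar linear combination of the files demanded by user `j`. -/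
def wanted (j : Fin K) (ω : Outcome F K N B σ.Rand) : Fin B → F :=
  ∑ n, σ.demand j ω n • σ.files ω n

/-- The constraints of the `(K, K', N)` hotplug model with private demands against colluding users:
they must hold whatever the (independent) distributions of the users' demands are. -/
structure IsPrivateHotplug (K' : ℕ) : Prop where
  files_indep_uniform : ∀ D : Fin K → (Fin N → F) → ℝ, (∀ j, D j ∈ stdSimplex ℝ (Fin N → F)) →
    entropy (σ.law D) σ.files = ∑ i, entropy (σ.law D) (fun ω => σ.files ω i) ∧
    ∑ i, entropy (σ.law D) (fun ω => σ.files ω i) = N * B * Real.log (Fintype.card F)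
  placement : ∀ D : Fin K → (Fin N → F) → ℝ, (∀ j, D j ∈ stdSimplex ℝ (Fin N → F)) →
    ∀ j, condEntropy (σ.law D) (σ.cache j) (fun ω => (σ.files ω, σ.tau j ω)) = 0
  delivery : ∀ D : Fin K → (Fin N → F) → ℝ, (∀ j, D j ∈ stdSimplex ℝ (Fin N → F)) →
    ∀ I : Finset (Fin K), I.card = K' →
    condEntropy (σ.law D) (σ.msg I) (fun ω => (σ.demands I ω, σ.files ω, σ.allTau ω)) = 0
  decoding : ∀ D : Fin K → (Fin N → F) → ℝ, (∀ j, D j ∈ stdSimplex ℝ (Fin N → F)) →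
    ∀ I : Finset (Fin K), I.card = K' → ∀ j ∈ I,
    condEntropy (σ.law D) (σ.wanted j) (fun ω => (σ.msg I ω, σ.demand j ω, σ.cache j ω)) = 0
  privacy : ∀ D : Fin K → (Fin N → F) → ℝ, (∀ j, D j ∈ stdSimplex ℝ (Fin N → F)) →
    ∀ I : Finset (Fin K), I.card = K' → ∀ A ⊆ I, A.Nonempty →
    condMutualInfo (σ.law D) (σ.demands (I \ A))
      (fun ω => (σ.msg I ω, σ.demands A ω, σ.caches A ω)) σ.files = 0

end Scheme

/-- The memory-load pair `(M, R)` is achievable in the `(K, K', N)` hotplug model with private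
demands: for all large file lengths `B` there is a scheme with caches of at most `M B` symbols and
transmitted signal of at most `(R + ε) B` symbols, that is, the limsup over `B` of the smallest
worst-case load at memory size `M` is at most `R`. -/
def Achievable (F : Type*) [Field F] [Fintype F] (K K' N : ℕ) (M R : ℝ) : Prop :=
  ∀ ε : ℝ, 0 < ε → ∀ᶠ B : ℕ in Filter.atTop, ∃ σ : Scheme F K N B,
    σ.IsPrivateHotplug K' ∧ (σ.cacheLen : ℝ) ≤ M * B ∧ (σ.msgLen : ℝ) ≤ (R + ε) * B

/-! ### Subpacketization -/

/-- A scheme with subpacketization level `L`: each file is split into `L` subfiles of equal length.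
A cache consists of `cacheLen` linear combinations of the `N * L` subfiles, with coefficients that
depend on the local randomness of its user. The transmitted signal consists of `dataLen` linear
combinations of the subfiles, whose coefficients depend on the active users, their demands and the
local randomness, and of `ctrlLen` control symbols, which do not depend on the files and whose
number does not depend on the length of the subfiles. -/
structure PacketScheme (F : Type*) (K N L : ℕ) where
  Rand : Fin K → Type
  [fintypeRand : ∀ j, Fintype (Rand j)]
  randLaw : (j : Fin K) → Rand j → ℝ
  randLaw_mem : ∀ j, randLaw j ∈ stdSimplex ℝ (Rand j)
  cacheLen : ℕ
  dataLen : ℕ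
  ctrlLen : ℕ
  cacheCoeff : (j : Fin K) → Rand j → Fin cacheLen → Fin N → Fin L → F
  dataCoeff : (I : Finset (Fin K)) → (I → Fin N → F) → ((j : Fin K) → Rand j) →
    Fin dataLen → Fin N → Fin L → F
  ctrl : (I : Finset (Fin K)) → (I → Fin N → F) → ((j : Fin K) → Rand j) → Fin ctrlLen → F

attribute [instance] PacketScheme.fintypeRand

/-- The subfile `l` (of length `m`) of a file of length `L * m`. -/
def subfile {F : Type*} {L m : ℕ} (f : Fin (L * m) → F) (l : Fin L) : Fin m → F :=
  fun c => f (finProdFinEquiv (l, c))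

/-- The list of the `r` linear combinations, with coefficients `a`, of all the subfiles, as a
sequence of `r * m` symbols. -/
def combine {F : Type*} [Field F] {N L m r : ℕ} (a : Fin r → Fin N → Fin L → F)
    (W : Fin N → Fin (L * m) → F) : Fin (r * m) → F :=
  fun i => (∑ n, ∑ l, a (finProdFinEquiv.symm i).1 n l • subfile (W n) l)
    (finProdFinEquiv.symm i).2

/-- A scheme with subpacketization level `L`, run on files of `L * m` symbols. -/
def PacketScheme.toScheme {F : Type*} [Field F] {K N L : ℕ} (P : PacketScheme F K N L) (m : ℕ) :
    Scheme F K N (L * m) where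
  Rand := P.Rand
  randLaw := P.randLaw
  randLaw_mem := P.randLaw_mem
  cacheLen := P.cacheLen * m
  msgLen := P.dataLen * m + P.ctrlLen
  cache j ω := combine (P.cacheCoeff j (ω.2.1 j)) ω.1
  msg I ω := Fin.append (combine (P.dataCoeff I (fun j => ω.2.2 j) ω.2.1) ω.1)
    (P.ctrl I (fun j => ω.2.2 j) ω.2.1)

/-- The memory-load pair `(M, R)` is attained with subpacketization level `L`: one scheme that
splits each file into `L` subfiles satisfies all constraints for subfiles of any length `m ≥ 1`, the
caches take `M B` symbols and the transmitted signal takes `R B` symbols for `B = L * m`, up to a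
number of control symbols that does not depend on `B`. -/
def AttainedWithLevel (F : Type*) [Field F] [Fintype F] (K K' N : ℕ) (M R : ℝ) (L : ℕ) : Prop :=
  ∃ P : PacketScheme F K N L, (∀ m : ℕ, 0 < m → (P.toScheme m).IsPrivateHotplug K') ∧
    (P.cacheLen : ℝ) = M * L ∧ (P.dataLen : ℝ) = R * L

/-! ### The tradeoff -/

/-- The lower convex envelope of a set of points of the plane, as a function of the abscissa. -/
def lowerConvexEnvelope (S : Set (ℝ × ℝ)) (x : ℝ) : ℝ :=
  sInf {y : ℝ | (x, y) ∈ convexHull ℝ S}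

/-- `(q ^ N - 1) / (q - 1)`; the division is exact. -/
def Ntilde (q N : ℕ) : ℕ := (q ^ N - 1) / (q - 1)

/-- The memory size `t N / (Ñ K)`. -/
def memBL (q K N t : ℕ) : ℝ := (t * N : ℝ) / (Ntilde q N * K)

/-- The load `(C(K Ñ, t + 1) - C(K Ñ - Ñ, t + 1)) / C(K Ñ, t)`. -/
def loadBL (q K N t : ℕ) : ℝ :=
  (((K * Ntilde q N).choose (t + 1) : ℝ) -
    ((K * Ntilde q N - Ntilde q N).choose (t + 1) : ℝ)) / ((K * Ntilde q N).choose t : ℝ)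

/-- The point `(0, N)` and the points `(memBL t, loadBL t)` for `t = 0, …, K Ñ`. -/
def pointsBL (q K N : ℕ) : Set (ℝ × ℝ) :=
  insert (0, (N : ℝ)) {x | ∃ t : ℕ, t ≤ K * Ntilde q N ∧ x = (memBL q K N t, loadBL q K N t)}

end

end Hotplug

/-! Up to scalars there are only `Ntilde` demands, one for each point of projective space. They are
labelled by a cyclic group `G` of that order. User `j` draws a uniform mask `τ j` in `G` and plays
the virtual user `(j, τ j)` among the `K * Ntilde` virtual users `(j, g)`. The server announces the
masked indices `p j = idx (d j) - τ j` (zero for inactive users) and serves all virtual users, `(j,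
g)` requesting combination `g + p j`. Thus `(j, τ j)` requests what user `j` wants, and every group
`j` requests each combination exactly once.

Privacy: the signal depends on the demands only through `p`. Replacing some demands and shifting
their masks accordingly preserves `p` and, the masks being uniform, changes the law only by the
demand factors; hence the hidden demands are independent of everything a coalition sees
(`prob_demands_eq_mul`).

Decoding and load: a file is a function on the `t`-sets of virtual users, and the transmissions form
the function `Y = ∑ i, g i (w i)` on `(t+1)`-sets, where `w i` is combination `i` and `g i` is the
sum of the creation operators of the virtual users requesting `i`. The canonical anticommutation
relations show that `Y` is determined by its values at sets meeting one fixed group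
(`sum_eq_zero_of_annihilated`), so only these are sent. Contracting `Y` with a user's own virtual
user isolates its combination, the other terms being cached (`eq_zero_of_sum_groupCreate_eq_zero`).
By linearity it is enough to treat kernels and one-symbol subfiles.

The envelope follows by memory sharing: schemes for consecutive pieces of the files use the same
masks, and the control symbols are sent once. -/

namespace Hotplug

noncomputable section

/-! ### Entropy criteria: functional dependence, independence, uniformity. -/

section Information

theorem prob_eq_sum_ite {Ω S : Type*} [Fintype Ω] [DecidableEq S] (p : Ω → ℝ) (X : Ω → S) (s : S) :
    prob p X s = ∑ ω, if X ω = s then p ω else 0 := by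
  rw [prob, Finset.sum_filter]
  congr!

variable {Ω S T U : Type*} [Fintype Ω] [Fintype S]

theorem sum_prob (p : Ω → ℝ) (X : Ω → S) : ∑ s, prob p X s = ∑ ω, p ω := by
  classical
  simp only [prob_eq_sum_ite]
  rw [Finset.sum_comm]
  simp

theorem sum_prob_prodMk (p : Ω → ℝ) (X : Ω → S) (Y : Ω → T) (y : T) :
    ∑ x, prob p (fun ω => (X ω, Y ω)) (x, y) = prob p Y y := by
  classical
  simp only [prob_eq_sum_ite, Prod.mk.injEq]
  rw [Finset.sum_comm]
  refine Finset.sum_congr rfl fun ω _ => ?_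
  by_cases h : Y ω = y <;> simp [h]

variable [Fintype T] [Fintype U]

theorem entropy_prodMk (p : Ω → ℝ) (X : Ω → S) (Y : Ω → T) :
    entropy p (fun ω => (X ω, Y ω)) =
      ∑ y, ∑ x, Real.negMulLog (prob p (fun ω => (X ω, Y ω)) (x, y)) := by
  rw [entropy, Fintype.sum_prod_type_right]

/-- A function of `Y` has no entropy given `Y`. -/
theorem condEntropy_eq_zero_of_factors (p : Ω → ℝ) (X : Ω → S) (Y : Ω → T)
    (h : ∀ ω ω', Y ω = Y ω' → X ω = X ω') : condEntropy p X Y = 0 := by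
  classical
  rw [condEntropy, entropy_prodMk, entropy, sub_eq_zero]
  refine Finset.sum_congr rfl fun y _ => ?_
  by_cases hy : ∃ ω, Y ω = y
  · obtain ⟨ω₀, rfl⟩ := hy
    -- `X` is constant on the fibre of `Y` through `ω₀`, so a single summand survives.
    rw [Finset.sum_eq_single (X ω₀)]
    · simp only [prob_eq_sum_ite]
      congr 1
      refine Finset.sum_congr rfl fun ω _ => ?_
      congr 1
      simpa only [Prod.mk.injEq, eq_iff_iff, and_iff_right_iff_imp] using h ω ω₀
    · intro x _ hx
      rw [prob_eq_sum_ite, Finset.sum_eq_zero, Real.negMulLog_zero]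
      refine fun ω _ => if_neg fun hω => ?_
      simp only [Prod.mk.injEq] at hω
      exact hx (hω.1.symm.trans (h _ _ hω.2))
    · simp
  · push Not at hy
    have h0 : ∀ x, prob p (fun ω => (X ω, Y ω)) (x, y) = 0 := fun x => by
      simp [prob, hy]
    have h1 : prob p Y y = 0 := by simp [prob, hy]
    simp [h0, h1]

/-- If `X` is independent of `Y`, with law `α`, then `H(X | Y)` is the entropy of `α`. -/
theorem condEntropy_of_prob_eq_mul {p : Ω → ℝ} (hp : ∑ ω, p ω = 1) {X : Ω → S} {Y : Ω → T}
    {α : S → ℝ} (hα : ∑ x, α x = 1)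
    (h : ∀ x y, prob p (fun ω => (X ω, Y ω)) (x, y) = α x * prob p Y y) :
    condEntropy p X Y = ∑ x, Real.negMulLog (α x) := by
  rw [condEntropy, entropy_prodMk, entropy]
  simp only [h, Real.negMulLog_mul, Finset.sum_add_distrib]
  simp only [← Finset.mul_sum, ← Finset.sum_mul, hα, one_mul]
  rw [sum_prob, hp]
  ring

/-- If `X` is independent of `(Y, Z)`, then `I(X ; Y | Z) = 0`. -/
theorem condMutualInfo_eq_zero_of_prob_eq_mul {p : Ω → ℝ} (hp : ∑ ω, p ω = 1) {X : Ω → S}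
    {Y : Ω → T} {Z : Ω → U} {α : S → ℝ} (hα : ∑ x, α x = 1)
    (h : ∀ x w, prob p (fun ω => (X ω, (Y ω, Z ω))) (x, w) =
      α x * prob p (fun ω => (Y ω, Z ω)) w) :
    condMutualInfo p X Y Z = 0 := by
  classical
  rw [condMutualInfo, condEntropy_of_prob_eq_mul hp hα h,
    condEntropy_of_prob_eq_mul hp hα, sub_self]
  -- Independence of `X` from `Z` alone follows by summing over the values of `Y`.
  intro x z
  rw [← sum_prob_prodMk p Y Z, Finset.mul_sum, Finset.sum_congr rfl fun y _ => (h x (y, z)).symm]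
  simp only [prob_eq_sum_ite, Prod.mk.injEq]
  rw [Finset.sum_comm]
  refine Finset.sum_congr rfl fun ω _ => ?_
  by_cases h : X ω = x <;> by_cases h' : Z ω = z <;> simp [h, h']

/-- A random variable whose values are exchanged by symmetries of the law is uniform. -/
theorem entropy_eq_log_card [Nonempty S] {p : Ω → ℝ} (hp : ∑ ω, p ω = 1) (X : Ω → S)
    (h : ∀ s s', ∃ e : Ω ≃ Ω, (∀ ω, p (e ω) = p ω) ∧ ∀ ω, X (e ω) = s' ↔ X ω = s) :
    entropy p X = Real.log (Fintype.card S) := by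
  classical
  have hconst : ∀ s s', prob p X s = prob p X s' := fun s s' => by
    obtain ⟨e, he, hX⟩ := h s s'
    rw [prob_eq_sum_ite, prob_eq_sum_ite, ← e.sum_comp fun ω => if X ω = s' then p ω else 0]
    simp only [he, hX]
  have hprob : ∀ s, prob p X s = (Fintype.card S : ℝ)⁻¹ := fun s => by
    have := sum_prob p X
    rw [Finset.sum_congr rfl (fun s' _ => hconst s' s), hp] at this
    simp only [Finset.sum_const, Finset.card_univ, nsmul_eq_mul] at this
    exact eq_inv_of_mul_eq_one_right this
  have hc : (Fintype.card S : ℝ) ≠ 0 := by exact_mod_cast Fintype.card_ne_zero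
  simp only [entropy, hprob, Real.negMulLog, Real.log_inv, Finset.sum_const, Finset.card_univ,
    nsmul_eq_mul]
  field_simp

end Information

theorem eq_of_append_eq {α : Type*} {m n : ℕ} {a a' : Fin m → α} {b b' : Fin n → α}
    (h : Fin.append a b = Fin.append a' b') : a = a' ∧ b = b' :=
  ⟨funext fun i => by simpa using congrFun h (Fin.castAdd n i),
    funext fun i => by simpa using congrFun h (Fin.natAdd m i)⟩

/-! ### Schemes with masked demands -/

section Substitution

variable {F : Type*} {G : Type} [AddCommGroup G] {K N B : ℕ} {idx : (Fin N → F) → G}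

open Classical in
/-- The demand indices of the active users, masked by the local randomness; the masked indices of
the inactive users are zero. -/
def maskedIndex (idx : (Fin N → F) → G) (I : Finset (Fin K)) (d : I → Fin N → F) (τ : Fin K → G) :
    Fin K → G :=
  fun k => if h : k ∈ I then idx (d ⟨k, h⟩) - τ k else 0

open Classical in
/-- Substitution of the demands of the users in `C` that keeps the masked demand indices. -/
def substDemands (idx : (Fin N → F) → G) (C : Finset (Fin K)) (a : C → Fin N → F)
    (ω : Outcome F K N B fun _ => G) : Outcome F K N B fun _ => G :=
  (ω.1, fun k => if h : k ∈ C then ω.2.1 k + (idx (a ⟨k, h⟩) - idx (ω.2.2 k)) else ω.2.1 k,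
    fun k => if h : k ∈ C then a ⟨k, h⟩ else ω.2.2 k)

theorem substDemands_of_mem (C : Finset (Fin K)) (a : C → Fin N → F)
    (ω : Outcome F K N B fun _ => G) {k : Fin K} (hk : k ∈ C) :
    (substDemands idx C a ω).2.1 k = ω.2.1 k + (idx (a ⟨k, hk⟩) - idx (ω.2.2 k)) ∧
      (substDemands idx C a ω).2.2 k = a ⟨k, hk⟩ := by
  simp [substDemands, hk]

theorem substDemands_of_notMem (C : Finset (Fin K)) (a : C → Fin N → F)
    (ω : Outcome F K N B fun _ => G) {k : Fin K} (hk : k ∉ C) :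
    (substDemands idx C a ω).2.1 k = ω.2.1 k ∧ (substDemands idx C a ω).2.2 k = ω.2.2 k := by
  simp [substDemands, hk]

/-- The mask moves by the same amount as the demand index, so their difference is unchanged. This is
why the signal does not notice the substitution. -/
theorem maskedIndex_substDemands (I C : Finset (Fin K)) (a : C → Fin N → F)
    (ω : Outcome F K N B fun _ => G) :
    maskedIndex idx I (fun j => (substDemands idx C a ω).2.2 j) (substDemands idx C a ω).2.1 =
      maskedIndex idx I (fun j => ω.2.2 j) ω.2.1 := by
  ext k
  simp only [maskedIndex]
  split_ifs
  · by_cases hk : k ∈ C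
    · rw [(substDemands_of_mem C a ω hk).1, (substDemands_of_mem C a ω hk).2]
      abel
    · rw [(substDemands_of_notMem C a ω hk).1, (substDemands_of_notMem C a ω hk).2]
  · rfl

/-- Restoring the original demands restores the masks too; this makes substitution a bijection
between the outcomes with demands `a` and those with demands `a'`. -/
theorem substDemands_substDemands (C : Finset (Fin K)) (a a' : C → Fin N → F)
    (ω : Outcome F K N B fun _ => G) (hω : (fun j : C => ω.2.2 j) = a) :
    substDemands idx C a (substDemands idx C a' ω) = ω := by
  refine Prod.ext rfl (Prod.ext (funext fun k => ?_) (funext fun k => ?_)) <;>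
  by_cases hk : k ∈ C
  · rw [(substDemands_of_mem C _ _ hk).1, (substDemands_of_mem C _ _ hk).1,
      (substDemands_of_mem C _ _ hk).2, ← hω]
    abel
  · rw [(substDemands_of_notMem C _ _ hk).1, (substDemands_of_notMem C _ _ hk).1]
  · rw [(substDemands_of_mem C _ _ hk).2, ← hω]
  · rw [(substDemands_of_notMem C _ _ hk).2, (substDemands_of_notMem C _ _ hk).2]

theorem demands_substDemands (C : Finset (Fin K)) (a : C → Fin N → F)
    (ω : Outcome F K N B fun _ => G) : (fun j : C => (substDemands idx C a ω).2.2 j) = a :=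
  funext fun j => (substDemands_of_mem C a ω j.2).2

end Substitution

section Masked

variable {F : Type*} [Fintype F] {K N B : ℕ}

variable {G : Type} [AddCommGroup G] [Fintype G]

theorem uniform_mem_stdSimplex : (fun _ : G => (Fintype.card G : ℝ)⁻¹) ∈ stdSimplex ℝ G := by
  refine ⟨fun _ => by positivity, ?_⟩
  have h : (Fintype.card G : ℝ) ≠ 0 := by exact_mod_cast Fintype.card_ne_zero
  simp [h]

/-- The scheme in which each user has a uniform mask, caches depend on the mask and the files, and
the signal consists of data that depend on the masked demand indices and the files, and of an
encoding of the masked demand indices. -/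
def maskedScheme {c r s : ℕ} (idx : (Fin N → F) → G)
    (cacheFn : Fin K → G → (Fin N → Fin B → F) → Fin c → F)
    (dataFn : (Fin K → G) → (Fin N → Fin B → F) → Fin r → F)
    (ctrl : (Fin K → G) → Fin s → F) : Scheme F K N B where
  Rand _ := G
  randLaw _ _ := (Fintype.card G : ℝ)⁻¹
  randLaw_mem _ := uniform_mem_stdSimplex
  cacheLen := c
  msgLen := r + s
  cache j ω := cacheFn j (ω.2.1 j) ω.1
  msg I ω := Fin.append (dataFn (maskedIndex idx I (fun j => ω.2.2 j) ω.2.1) ω.1)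
    (ctrl (maskedIndex idx I (fun j => ω.2.2 j) ω.2.1))

variable {c r s : ℕ} {idx : (Fin N → F) → G}
    {cacheFn : Fin K → G → (Fin N → Fin B → F) → Fin c → F}
    {dataFn : (Fin K → G) → (Fin N → Fin B → F) → Fin r → F}
    {ctrl : (Fin K → G) → Fin s → F}

/-- The demands of the users in `C` are independent of any random variable that depends only on
what `substDemands` keeps. -/
theorem prob_demands_eq_mul {T : Type*} [Fintype T] {D : Fin K → (Fin N → F) → ℝ}
    (hD : ∀ j, D j ∈ stdSimplex ℝ (Fin N → F)) (C : Finset (Fin K))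
    (Y : Outcome F K N B (fun _ => G) → T) (hY : ∀ a ω, Y (substDemands idx C a ω) = Y ω)
    (a : C → Fin N → F) (y : T) :
    prob ((maskedScheme idx cacheFn dataFn ctrl).law D)
        (fun ω => ((maskedScheme idx cacheFn dataFn ctrl).demands C ω, Y ω)) (a, y) =
      (∏ j : C, D j (a j)) * prob ((maskedScheme idx cacheFn dataFn ctrl).law D) Y y := by
  classical
  set σ := maskedScheme idx cacheFn dataFn ctrl
  -- Masks are uniform, so only the demand factors change. The relation is cross-multiplied because
  -- these factors may be zero.
  have hlaw : ∀ (a' : C → Fin N → F) (ω : Outcome F K N B fun _ => G),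
      σ.law D (substDemands idx C a' ω) * ∏ j : C, D j (ω.2.2 j) =
        (∏ j : C, D j (a' j)) * σ.law D ω := fun a' ω => by
    have h1 : ∀ d : Fin K → Fin N → F,
        ∏ j, D j (d j) = (∏ j : C, D j (d j)) * ∏ j ∈ Cᶜ, D j (d j) := fun d => by
      rw [← Finset.prod_mul_prod_compl C, ← Finset.prod_coe_sort C]
    have h2 : ∏ j ∈ Cᶜ, D j ((substDemands idx C a' ω).2.2 j) = ∏ j ∈ Cᶜ, D j (ω.2.2 j) :=
      Finset.prod_congr rfl fun j hj => by
        rw [(substDemands_of_notMem C a' ω (Finset.mem_compl.1 hj)).2]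
    have h3 : ∏ j : C, D j ((substDemands idx C a' ω).2.2 j) = ∏ j : C, D j (a' j) :=
      Finset.prod_congr rfl fun j _ => by
        rw [(substDemands_of_mem C a' ω j.2).2]
    change (_ * (∏ _j : Fin K, (Fintype.card G : ℝ)⁻¹) * _) * _ =
      _ * (_ * (∏ _j : Fin K, (Fintype.card G : ℝ)⁻¹) * _)
    rw [h1 ω.2.2, h1 (substDemands idx C a' ω).2.2, h2, h3]
    ring
  have hswap : ∀ a a' : C → Fin N → F,
      prob (σ.law D) (fun ω => (σ.demands C ω, Y ω)) (a, y) * ∏ j : C, D j (a' j) =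
        (∏ j : C, D j (a j)) * prob (σ.law D) (fun ω => (σ.demands C ω, Y ω)) (a', y) :=
    fun a a' => by
    rw [prob_eq_sum_ite, prob_eq_sum_ite, ← Finset.sum_filter, ← Finset.sum_filter,
      Finset.sum_mul, Finset.mul_sum]
    refine Finset.sum_bij' (fun ω _ => substDemands idx C a' ω)
      (fun ω _ => substDemands idx C a ω) ?_ ?_ ?_ ?_ ?_
    · intro ω hω
      simp only [Finset.mem_filter, Finset.mem_univ, true_and, Prod.mk.injEq] at hω
      exact Finset.mem_filter.2 ⟨Finset.mem_univ _,
        Prod.ext (demands_substDemands (idx := idx) C a' ω) ((hY a' ω).trans hω.2)⟩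
    · intro ω hω
      simp only [Finset.mem_filter, Finset.mem_univ, true_and, Prod.mk.injEq] at hω
      exact Finset.mem_filter.2 ⟨Finset.mem_univ _,
        Prod.ext (demands_substDemands (idx := idx) C a ω) ((hY a ω).trans hω.2)⟩
    · intro ω hω
      simp only [Finset.mem_filter, Finset.mem_univ, true_and, Prod.mk.injEq] at hω
      exact substDemands_substDemands C a a' ω hω.1
    · intro ω hω
      simp only [Finset.mem_filter, Finset.mem_univ, true_and, Prod.mk.injEq] at hω
      exact substDemands_substDemands C a' a ω hω.1
    · intro ω hω
      simp only [Finset.mem_filter, Finset.mem_univ, true_and, Prod.mk.injEq] at hω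
      rw [mul_comm, ← hlaw a' ω, mul_comm, ← hω.1]
      rfl
  have hsum : ∑ a' : C → Fin N → F, ∏ j : C, D j (a' j) = 1 := by
    rw [← Fintype.prod_sum (fun (j : C) v => D j v)]
    exact Finset.prod_eq_one fun j _ => (hD j).2
  -- Summing `hswap` over `a'` removes the factor on the left, whose total is one, and leaves the
  -- marginal of `Y` on the right.
  rw [← sum_prob_prodMk _ (σ.demands C) Y, Finset.mul_sum]
  erw [Finset.sum_congr rfl fun a' _ => (hswap a a').symm]
  rw [← Finset.mul_sum, hsum, mul_one]

variable [Field F]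

theorem Scheme.sum_law (σ : Scheme F K N B) {D : Fin K → (Fin N → F) → ℝ}
    (hD : ∀ j, D j ∈ stdSimplex ℝ (Fin N → F)) : ∑ ω, σ.law D ω = 1 := by
  classical
  have h1 : ∑ τ : (j : Fin K) → σ.Rand j, ∏ j, σ.randLaw j (τ j) = 1 := by
    rw [← Fintype.prod_sum]
    exact Finset.prod_eq_one fun j _ => (σ.randLaw_mem j).2
  have h2 : ∑ d : Fin K → Fin N → F, ∏ j, D j (d j) = 1 := by
    rw [← Fintype.prod_sum]
    exact Finset.prod_eq_one fun j _ => (hD j).2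
  have hq : (Fintype.card F : ℝ) ≠ 0 := by exact_mod_cast Fintype.card_ne_zero
  simp only [Scheme.law, Fintype.sum_prod_type, ← Finset.mul_sum, h2, mul_one, h1]
  simp only [Finset.sum_const, Finset.card_univ, Fintype.card_pi, Finset.prod_const,
    Fintype.card_fin, nsmul_eq_mul, Nat.cast_pow, ← pow_mul]
  rw [mul_comm B N]
  exact mul_inv_cancel₀ (pow_ne_zero _ hq)

/-- Translation of the files. -/
def Scheme.translate (σ : Scheme F K N B) (v : Fin N → Fin B → F) :
    Outcome F K N B σ.Rand ≃ Outcome F K N B σ.Rand :=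
  (Equiv.addRight v).prodCongr (Equiv.refl _)

theorem Scheme.files_entropy (σ : Scheme F K N B) {D : Fin K → (Fin N → F) → ℝ}
    (hD : ∀ j, D j ∈ stdSimplex ℝ (Fin N → F)) :
    entropy (σ.law D) σ.files = N * B * Real.log (Fintype.card F) := by
  rw [entropy_eq_log_card (σ.sum_law hD)]
  · simp [Real.log_pow, Fintype.card_pi]
    ring
  · refine fun s s' => ⟨σ.translate (s' - s), fun ω => rfl, fun ω => ?_⟩
    change ω.1 + (s' - s) = s' ↔ ω.1 = s
    rw [← add_sub_assoc, sub_eq_iff_eq_add, add_comm, add_right_inj]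

theorem Scheme.file_entropy (σ : Scheme F K N B) {D : Fin K → (Fin N → F) → ℝ}
    (hD : ∀ j, D j ∈ stdSimplex ℝ (Fin N → F)) (i : Fin N) :
    entropy (σ.law D) (fun ω => σ.files ω i) = B * Real.log (Fintype.card F) := by
  rw [entropy_eq_log_card (σ.sum_law hD)]
  · simp [Real.log_pow, Fintype.card_pi]
  · refine fun s s' => ⟨σ.translate (fun _ => s' - s), fun ω => rfl, fun ω => ?_⟩
    change ω.1 i + (s' - s) = s' ↔ ω.1 i = s
    rw [← add_sub_assoc, sub_eq_iff_eq_add, add_comm, add_right_inj]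

/-- A user that knows its mask, the masked demand indices, its cache and the data knows its
combination of the files. -/
def Decodes (idx : (Fin N → F) → G)
    (cacheFn : Fin K → G → (Fin N → Fin B → F) → Fin c → F)
    (dataFn : (Fin K → G) → (Fin N → Fin B → F) → Fin r → F) : Prop :=
  ∀ j g p d, idx d = g + p j → ∀ W W', cacheFn j g W = cacheFn j g W' → dataFn p W = dataFn p W' →
    ∑ n, d n • W n = ∑ n, d n • W' n

/-- The control symbols reveal the masked indices; together with its own demand, a user thereby
recovers its mask, so `Decodes` applies. For privacy, substituting the demands of `I \ A` keeps the
signal, the files, and the demands and caches of `A`. -/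
theorem maskedScheme_isPrivateHotplug (hdec : Decodes idx cacheFn dataFn)
    (hctrl : Function.Injective ctrl) (K' : ℕ) :
    (maskedScheme idx cacheFn dataFn ctrl).IsPrivateHotplug K' where
  files_indep_uniform D hD := by
    simp only [Scheme.files_entropy _ hD, Scheme.file_entropy _ hD]
    simp [mul_assoc]
  placement D _ j := condEntropy_eq_zero_of_factors _ _ _ fun ω ω' h => by
    simp only [Prod.mk.injEq] at h
    change cacheFn j (ω.2.1 j) ω.1 = cacheFn j (ω'.2.1 j) ω'.1
    have h1 : ω.1 = ω'.1 := h.1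
    have h2 : ω.2.1 j = ω'.2.1 j := h.2
    rw [h1, h2]
  delivery D _ I _ := condEntropy_eq_zero_of_factors _ _ _ fun ω ω' h => by
    simp only [Prod.mk.injEq] at h
    have h1 : (fun j : I => ω.2.2 j) = fun j : I => ω'.2.2 j := h.1
    have h2 : ω.1 = ω'.1 := h.2.1
    have h3 : ω.2.1 = ω'.2.1 := h.2.2
    simp only [maskedScheme]
    rw [h1, h2, h3]
  decoding D _ I _ j hj := condEntropy_eq_zero_of_factors _ _ _ fun ω ω' h => by
    simp only [Prod.mk.injEq] at h
    obtain ⟨hmsg, hd, hc⟩ := h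
    have hd : ω.2.2 j = ω'.2.2 j := hd
    obtain ⟨hdata, hct⟩ := eq_of_append_eq hmsg
    have hp := hctrl hct
    rw [← hp] at hdata
    have hpj := congrFun hp j
    simp only [maskedIndex, hj, dif_pos, hd, sub_right_inj] at hpj
    change cacheFn j (ω.2.1 j) ω.1 = cacheFn j (ω'.2.1 j) ω'.1 at hc
    rw [← hpj] at hc
    change ∑ n, ω.2.2 j n • ω.1 n = ∑ n, ω'.2.2 j n • ω'.1 n
    rw [← hd]
    refine hdec j _ _ _ ?_ _ _ hc hdata
    simp only [maskedIndex, hj, dif_pos]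
    abel
  privacy D hD I _ A _ _ := by
    refine condMutualInfo_eq_zero_of_prob_eq_mul (Scheme.sum_law _ hD)
      (α := fun a => ∏ j : (I \ A : Finset (Fin K)), D j (a j)) ?_
      (fun a y => prob_demands_eq_mul hD _ _ (fun a ω => ?_) a y)
    · rw [← Fintype.prod_sum (fun (j : (I \ A : Finset (Fin K))) v => D j v)]
      exact Finset.prod_eq_one fun j _ => (hD j).2
    · have hA : ∀ j : A, (j : Fin K) ∉ I \ A := fun j hj => (Finset.mem_sdiff.1 hj).2 j.2
      refine Prod.ext (Prod.ext ?_ (Prod.ext ?_ ?_)) rfl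
      · simp only [maskedScheme]
        rw [maskedIndex_substDemands]
        rfl
      · exact funext fun j => (substDemands_of_notMem (idx := idx) _ a ω (hA j)).2
      · refine funext fun j => ?_
        change cacheFn j ((substDemands idx (I \ A) a ω).2.1 j) ω.1 = cacheFn j (ω.2.1 j) ω.1
        rw [(substDemands_of_notMem _ a ω (hA j)).1]

end Masked

/-! ### Creation and annihilation operators -/

section Fermion

variable {F U : Type*} [CommRing F] [LinearOrder U]

/-- The sign of `u` with respect to the set `S`. -/
def fermionSign (F : Type*) [CommRing F] (u : U) (S : Finset U) : F :=
  (-1) ^ (S.filter (· < u)).card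

theorem fermionSign_mul_self (u : U) (S : Finset U) :
    fermionSign F u S * fermionSign F u S = 1 := by
  rw [fermionSign, ← mul_pow]
  simp

theorem fermionSign_insert_self (u : U) (S : Finset U) :
    fermionSign F u (insert u S) = fermionSign F u S := by
  simp [fermionSign, Finset.filter_insert]

theorem fermionSign_insert {u v : U} {S : Finset U} (hv : v ∉ S) :
    fermionSign F u (insert v S) = (if v < u then -1 else 1) * fermionSign F u S := by
  rw [fermionSign, fermionSign, Finset.filter_insert]
  split_ifs with h
  · rw [Finset.card_insert_of_notMem (by simp [hv]), pow_succ]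
    ring
  · simp

theorem fermionSign_erase_self (u : U) (S : Finset U) :
    fermionSign F u (S.erase u) = fermionSign F u S := by
  rw [← fermionSign_insert_self u (S.erase u)]
  by_cases h : u ∈ S
  · rw [Finset.insert_erase h]
  · rw [Finset.erase_eq_of_notMem h, fermionSign_insert_self]

theorem fermionSign_erase {u v : U} {S : Finset U} (hv : v ∈ S) :
    fermionSign F u (S.erase v) = (if v < u then -1 else 1) * fermionSign F u S := by
  have h := fermionSign_insert (F := F) (u := u) (Finset.notMem_erase v S)
  rw [Finset.insert_erase hv] at h
  rw [h, ← mul_assoc]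
  split_ifs <;> simp

/-- The exterior product with the basis vector `u`, in coordinates. -/
def create (u : U) : (Finset U → F) →ₗ[F] (Finset U → F) where
  toFun f S := if u ∈ S then fermionSign F u S * f (S.erase u) else 0
  map_add' f g := by
    ext S
    simp only [Pi.add_apply]
    split_ifs <;> ring
  map_smul' a f := by
    ext S
    simp only [Pi.smul_apply, smul_eq_mul, RingHom.id_apply]
    split_ifs <;> ring

/-- The contraction with the dual basis vector of `u`, in coordinates. -/
def annihilate (u : U) : (Finset U → F) →ₗ[F] (Finset U → F) where
  toFun f S := if u ∈ S then 0 else fermionSign F u S * f (insert u S)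
  map_add' f g := by
    ext S
    simp only [Pi.add_apply]
    split_ifs <;> ring
  map_smul' a f := by
    ext S
    simp only [Pi.smul_apply, smul_eq_mul, RingHom.id_apply]
    split_ifs <;> ring

theorem create_apply (u : U) (f : Finset U → F) (S : Finset U) :
    create u f S = if u ∈ S then fermionSign F u S * f (S.erase u) else 0 := rfl

theorem annihilate_apply (u : U) (f : Finset U → F) (S : Finset U) :
    annihilate u f S = if u ∈ S then 0 else fermionSign F u S * f (insert u S) := rfl

theorem create_create_self (u : U) (f : Finset U → F) : create u (create u f) = 0 := by
  ext S
  simp [create_apply]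

/-- The two orders of removal differ in exactly one sign: only the larger of `u` and `v` sees the
other below it. -/
theorem create_create_comm (u v : U) (f : Finset U → F) :
    create u (create v f) = -create v (create u f) := by
  rcases eq_or_ne u v with rfl | huv
  · simp [create_create_self]
  ext S
  by_cases hu : u ∈ S <;> by_cases hv : v ∈ S
  · simp only [create_apply, hu, hv, Finset.mem_erase, huv, huv.symm, ne_eq, not_false_eq_true,
      and_self, if_true, Pi.neg_apply]
    rw [fermionSign_erase hu, fermionSign_erase hv, Finset.erase_right_comm]
    rcases lt_or_gt_of_ne huv with h | h <;> simp only [h, h.not_gt, if_true, if_false] <;> ring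
  all_goals simp [create_apply, hu, hv]

/-- The canonical anticommutation relation, the only link between contraction and exterior product
that the decoding needs. -/
theorem annihilate_create (u v : U) (f : Finset U → F) :
    annihilate u (create v f) = (if u = v then f else 0) - create v (annihilate u f) := by
  rcases eq_or_ne u v with rfl | huv
  · ext S
    by_cases hu : u ∈ S
    · simp [create_apply, annihilate_apply, hu, fermionSign_erase_self, ← mul_assoc,
        fermionSign_mul_self, Finset.insert_erase]
    · simp [create_apply, annihilate_apply, hu, fermionSign_insert_self, ← mul_assoc,
        fermionSign_mul_self]
  · ext S
    by_cases hu : u ∈ S <;> by_cases hv : v ∈ S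
    · simp [create_apply, annihilate_apply, hu, huv]
    · simp [create_apply, annihilate_apply, hu, hv, huv]
    · simp only [create_apply, annihilate_apply, hu, hv, huv, Finset.mem_erase, Finset.mem_insert,
        if_true, if_false, Pi.sub_apply, Pi.zero_apply, zero_sub, or_true, and_false]
      rw [fermionSign_erase hv, fermionSign_insert hu, Finset.erase_insert_of_ne huv]
      rcases lt_or_gt_of_ne huv with h | h <;> simp only [h, h.not_gt, if_true, if_false] <;> ring
    · simp [create_apply, annihilate_apply, hu, hv, huv, huv.symm]

/-- If `f` vanishes on all sets that contain `u`, its contraction with `u` vanishes. -/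
theorem annihilate_eq_zero {u : U} {f : Finset U → F} (h : ∀ S, u ∈ S → f S = 0) :
    annihilate u f = 0 := by
  ext S
  simp [annihilate_apply, h]

end Fermion

/-! ### Sums over disjoint groups -/

section Sums

variable {F V G : Type*} [CommRing F] [AddCommGroup V] [Module F V] [DecidableEq G]

/-- Abstract redundancy of the transmissions that no leader is involved in: an element of the form
`∑ g_i w_i` that is annihilated by the leaders `c_i` is zero. -/
theorem sum_eq_zero_of_annihilated (g c : G → V →ₗ[F] V) (hsq : ∀ i v, g i (g i v) = 0)
    (hanti : ∀ i k v, g i (g k v) = -g k (g i v))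
    (hcar : ∀ i k v, c i (g k v) = (if i = k then v else 0) - g k (c i v))
    (s : Finset G) (w : G → V) (h : ∀ i ∈ s, c i (∑ k ∈ s, g k (w k)) = 0) :
    ∑ k ∈ s, g k (w k) = 0 := by
  induction s using Finset.induction_on generalizing w with
  | empty => simp
  | insert i s hi ih =>
    have h0 := h i (Finset.mem_insert_self i s)
    rw [Finset.sum_insert hi, map_add, hcar, if_pos rfl, map_sum,
      Finset.sum_congr rfl (g := fun k => -g k (c i (w k))) (fun k hk => by
        rw [hcar, if_neg (by rintro rfl; exact hi hk), zero_sub]),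
      Finset.sum_neg_distrib] at h0
    -- Annihilation by leader `i` expresses `w i` through the images of the operators.
    have hw : w i = g i (c i (w i)) + ∑ k ∈ s, g k (c i (w k)) := by
      rw [← sub_eq_zero, ← h0]
      abel
    -- In `g i (w i)` the first term dies since `g i` squares to zero, and anticommuting moves the
    -- rest under the other `g k`. The total is unchanged, so the remaining leaders still annihilate
    -- it.
    have hY : ∑ k ∈ insert i s, g k (w k) = ∑ k ∈ s, g k (w k - g i (c i (w k))) := by
      rw [Finset.sum_insert hi]
      conv_lhs => rw [hw]
      rw [map_add, hsq, zero_add, map_sum, ← Finset.sum_add_distrib]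
      refine Finset.sum_congr rfl fun k _ => ?_
      rw [hanti, map_sub]
      abel
    rw [hY]
    refine ih _ fun k hk => ?_
    rw [← hY]
    exact h k (Finset.mem_insert_of_mem hk)

end Sums

section Groups

variable {F U J G : Type*} [CommRing F] [LinearOrder U] [Fintype J] [AddCommGroup G]

/-- The sum of the creation operators of the virtual users that request combination `i`, when the
requests of group `j` are shifted by `p j`. -/
def groupCreate (e : J × G ≃ U) (p : J → G) (i : G) : (Finset U → F) →ₗ[F] (Finset U → F) :=
  ∑ j, create (e (j, i - p j))

theorem groupCreate_apply (e : J × G ≃ U) (p : J → G) (i : G) (f : Finset U → F) :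
    groupCreate e p i f = ∑ j, create (e (j, i - p j)) f := by
  simp [groupCreate]

theorem groupCreate_comm (e : J × G ≃ U) (p : J → G) (i k : G) (f : Finset U → F) :
    groupCreate e p i (groupCreate e p k f) = -groupCreate e p k (groupCreate e p i f) := by
  simp only [groupCreate_apply, map_sum]
  rw [Finset.sum_comm, ← Finset.sum_neg_distrib]
  refine Finset.sum_congr rfl fun a _ => ?_
  rw [← Finset.sum_neg_distrib]
  exact Finset.sum_congr rfl fun b _ => create_create_comm _ _ _

/-- Diagonal terms vanish and the others cancel in pairs. Anticommutation alone would not give this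
in characteristic two. -/
theorem sum_create_sum_create {A : Type*} (s : Finset A) (u : A → U) (f : Finset U → F) :
    ∑ a ∈ s, create (u a) (∑ b ∈ s, create (u b) f) = 0 := by
  classical
  induction s using Finset.induction_on with
  | empty => simp
  | insert a s ha ih =>
    simp only [map_sum] at ih ⊢
    simp only [Finset.sum_insert ha, create_create_self, zero_add, Finset.sum_add_distrib, ih,
      add_zero]
    rw [← Finset.sum_add_distrib]
    refine Finset.sum_eq_zero fun b _ => ?_
    rw [create_create_comm]
    simp

theorem groupCreate_self (e : J × G ≃ U) (p : J → G) (i : G) (f : Finset U → F) :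
    groupCreate e p i (groupCreate e p i f) = 0 := by
  simp only [groupCreate_apply]
  exact sum_create_sum_create _ _ _

/-- Group `j` requests each combination exactly once, so the contracted virtual user occurs in
`groupCreate e p k` only if `i = k`, and then once. -/
theorem annihilate_groupCreate [DecidableEq G] (e : J × G ≃ U) (p : J → G) (j : J) (i k : G)
    (f : Finset U → F) :
    annihilate (e (j, i - p j)) (groupCreate e p k f) =
      (if i = k then f else 0) - groupCreate e p k (annihilate (e (j, i - p j)) f) := by
  classical
  simp only [groupCreate_apply, map_sum, annihilate_create, Finset.sum_sub_distrib]
  congr 1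
  rw [Finset.sum_eq_single j]
  · simp
  · intro b _ hb
    rw [if_neg]
    simp [hb.symm]
  · simp

/-- The multicast transmissions vanish if those that involve group `j` vanish. -/
theorem sum_groupCreate_eq_zero [Fintype G] (e : J × G ≃ U) (p : J → G) (j : J)
    (w : G → Finset U → F)
    (h : ∀ S, (∃ i, e (j, i) ∈ S) → (∑ k, groupCreate e p k (w k)) S = 0) :
    ∑ k, groupCreate e p k (w k) = 0 := by
  classical
  refine sum_eq_zero_of_annihilated (groupCreate e p) (fun i => annihilate (e (j, i - p j)))
    (groupCreate_self e p) (groupCreate_comm e p) (annihilate_groupCreate e p j) _ w fun i _ => ?_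
  exact annihilate_eq_zero fun S hS => h S ⟨_, hS⟩

/-- A user that caches the coefficients at all sets containing its virtual user recovers its
combination. -/
theorem eq_zero_of_sum_groupCreate_eq_zero [Fintype G] (e : J × G ≃ U) (p : J → G) (j : J) (s : G)
    (w : G → Finset U → F) (hY : ∑ k, groupCreate e p k (w k) = 0)
    (h : ∀ k S, e (j, s) ∈ S → w k S = 0) : w (s + p j) = 0 := by
  classical
  have h0 : annihilate (e (j, s + p j - p j)) (∑ k, groupCreate e p k (w k)) = 0 := by
    rw [hY, map_zero]
  have hz : ∀ k, annihilate (e (j, s + p j - p j)) (w k) = 0 := fun k =>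
    annihilate_eq_zero fun S hS => h k S (by simpa using hS)
  rw [map_sum] at h0
  -- The cached contractions vanish, and the Kronecker delta selects the requested combination.
  simpa only [annihilate_groupCreate, hz, map_zero, sub_zero, Finset.sum_ite_eq, Finset.mem_univ,
    if_true] using h0

/-- `groupCreate` raises the size of the sets by one. -/
theorem groupCreate_apply_eq_zero (e : J × G ≃ U) (p : J → G) (i : G) {f : Finset U → F} {t : ℕ}
    (hf : ∀ T, T.card ≠ t → f T = 0) {S : Finset U} (hS : S.card ≠ t + 1) :
    groupCreate e p i f S = 0 := by
  rw [groupCreate_apply, Finset.sum_apply]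
  refine Finset.sum_eq_zero fun j _ => ?_
  rw [create_apply]
  split_ifs with h
  · rw [hf, mul_zero]
    have := Finset.card_erase_add_one h
    omega
  · rfl

end Groups

/-! ### Linear schemes -/

section Linear

variable {F : Type*} [Field F] {K N L : ℕ}

/-- The coefficients of a list of linear combinations of subfiles. -/
def coefficients {r : ℕ} (A : (Fin N → Fin L → F) →ₗ[F] (Fin r → F)) :
    Fin r → Fin N → Fin L → F :=
  fun i n l => A (Pi.single n (Pi.single l 1)) i

theorem sum_coefficients_mul {r : ℕ} (A : (Fin N → Fin L → F) →ₗ[F] (Fin r → F))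
    (w : Fin N → Fin L → F) (i : Fin r) :
    ∑ n, ∑ l, coefficients A i n l * w n l = A w i := by
  have hw : w = ∑ n, ∑ l, w n l • (Pi.single n (Pi.single l 1) : Fin N → Fin L → F) := by
    ext n l
    simp only [Finset.sum_apply, Pi.smul_apply, smul_eq_mul]
    rw [Finset.sum_eq_single n, Finset.sum_eq_single l]
    · simp
    · intro k _ hk
      simp [hk.symm]
    · simp
    · intro k _ hk
      simp [hk.symm]
    · simp
  conv_rhs => rw [hw]
  simp only [map_sum, map_smul, Finset.sum_apply, Pi.smul_apply, smul_eq_mul, coefficients]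
  exact Finset.sum_congr rfl fun n _ => Finset.sum_congr rfl fun l _ => mul_comm _ _

theorem combine_coefficients {r m : ℕ} (A : (Fin N → Fin L → F) →ₗ[F] (Fin r → F))
    (W : Fin N → Fin (L * m) → F) (i : Fin r) (b : Fin m) :
    combine (coefficients A) W (finProdFinEquiv (i, b)) =
      A (fun n l => subfile (W n) l b) i := by
  rw [← sum_coefficients_mul]
  simp [combine, Finset.sum_apply]

variable {G : Type} [AddCommGroup G]

/-- The linear form of `Decodes`, for subfiles of one symbol. -/
def LinearlyDecodes {c r : ℕ} (idx : (Fin N → F) → G)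
    (Z : Fin K → G → (Fin N → Fin L → F) →ₗ[F] (Fin c → F))
    (X : (Fin K → G) → (Fin N → Fin L → F) →ₗ[F] (Fin r → F)) : Prop :=
  ∀ j g p d, idx d = g + p j → ∀ w, Z j g w = 0 → X p w = 0 → ∑ n, d n • w n = 0

/-- Packet combinations act on each symbol position separately. At each position the difference of
two file tuples with equal cache and data lies in both kernels. -/
theorem LinearlyDecodes.decodes {c r : ℕ} {idx : (Fin N → F) → G}
    {Z : Fin K → G → (Fin N → Fin L → F) →ₗ[F] (Fin c → F)}
    {X : (Fin K → G) → (Fin N → Fin L → F) →ₗ[F] (Fin r → F)} (h : LinearlyDecodes idx Z X)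
    (m : ℕ) :
    Decodes (B := L * m) idx (fun j g => combine (coefficients (Z j g)))
      (fun p => combine (coefficients (X p))) := by
  intro j g p d hd W W' hZ hX
  ext i
  obtain ⟨⟨l, b⟩, rfl⟩ := finProdFinEquiv.surjective i
  have key : ∀ {r : ℕ} (A : (Fin N → Fin L → F) →ₗ[F] (Fin r → F)),
      combine (coefficients A) W = combine (coefficients A) W' →
      A ((fun n l => subfile (W n) l b) - fun n l => subfile (W' n) l b) = 0 := fun A hA => by
    ext i
    rw [map_sub, Pi.sub_apply, ← combine_coefficients, ← combine_coefficients, hA, sub_self]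
    rfl
  have h0 := congrFun (h j g p d hd _ (key _ hZ) (key _ hX)) l
  simp only [Finset.sum_apply, Pi.smul_apply, Pi.sub_apply, smul_eq_mul, mul_sub,
    Finset.sum_sub_distrib, Pi.zero_apply, sub_eq_zero] at h0
  simpa [Finset.sum_apply, subfile] using h0

/-- The linear scheme with given coefficients and with masked demand indices as control symbols. -/
def linearPacketScheme [Fintype G] {c r s : ℕ} (idx : (Fin N → F) → G)
    (Z : Fin K → G → (Fin N → Fin L → F) →ₗ[F] (Fin c → F))
    (X : (Fin K → G) → (Fin N → Fin L → F) →ₗ[F] (Fin r → F))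
    (ctrl : (Fin K → G) → Fin s → F) : PacketScheme F K N L where
  Rand _ := G
  randLaw _ _ := (Fintype.card G : ℝ)⁻¹
  randLaw_mem _ := uniform_mem_stdSimplex
  cacheLen := c
  dataLen := r
  ctrlLen := s
  cacheCoeff j g := coefficients (Z j g)
  dataCoeff I d τ := coefficients (X (maskedIndex idx I d τ))
  ctrl I d τ := ctrl (maskedIndex idx I d τ)

theorem linearPacketScheme_isPrivateHotplug [Fintype F] [Fintype G] {c r s : ℕ}
    {idx : (Fin N → F) → G} {Z : Fin K → G → (Fin N → Fin L → F) →ₗ[F] (Fin c → F)}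
    {X : (Fin K → G) → (Fin N → Fin L → F) →ₗ[F] (Fin r → F)} (h : LinearlyDecodes idx Z X)
    {ctrl : (Fin K → G) → Fin s → F} (hctrl : Function.Injective ctrl) (m K' : ℕ) :
    ((linearPacketScheme idx Z X ctrl).toScheme m).IsPrivateHotplug K' :=
  maskedScheme_isPrivateHotplug (h.decodes m) hctrl K'

end Linear

/-! ### Counting -/

theorem card_subtype_not_disjoint {U : Type*} [Fintype U] [DecidableEq U] (s : Finset U) (t : ℕ) :
    Fintype.card {T : Finset U // T.card = t ∧ ¬Disjoint T s} =
      (Fintype.card U).choose t - (Fintype.card U - s.card).choose t := by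
  have h : (Finset.univ.filter fun T : Finset U => T.card = t ∧ ¬Disjoint T s) =
      Finset.powersetCard t Finset.univ \ Finset.powersetCard t sᶜ := by
    ext T
    simp only [Finset.mem_filter, Finset.mem_univ, true_and, Finset.mem_sdiff,
      Finset.mem_powersetCard, Finset.subset_univ, Finset.subset_compl_iff_disjoint_right]
    tauto
  rw [Fintype.card_subtype, h,
    Finset.card_sdiff_of_subset (Finset.powersetCard_mono (Finset.subset_univ _)),
    Finset.card_powersetCard, Finset.card_powersetCard, Finset.card_compl, Finset.card_univ]

/-- Both sides count pairs of a `t`-subset and an element of it. -/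
theorem mul_choose_sub_choose (n t : ℕ) (hn : 0 < n) :
    n * (n.choose t - (n - 1).choose t) = t * n.choose t := by
  obtain ⟨k, rfl⟩ := Nat.exists_eq_succ_of_ne_zero hn.ne'
  cases t with
  | zero => simp
  | succ t =>
    simp only [Nat.succ_eq_add_one, Nat.add_sub_cancel]
    rw [mul_comm (t + 1), ← Nat.add_one_mul_choose_eq, Nat.choose_succ_succ, Nat.add_sub_cancel]

/-! ### The multicast scheme -/

section Multicast

variable {F : Type*} [Field F] {K N L t : ℕ} {U : Type*}

/-- The coefficients of the files at the sets of size `t`, extended by zero to all sets. -/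
def extendByZero (eT : {T : Finset U // T.card = t} ≃ Fin L) :
    (Fin N → Fin L → F) →ₗ[F] (Fin N → Finset U → F) :=
  LinearMap.pi fun n => LinearMap.pi fun T =>
    if h : T.card = t then LinearMap.proj (eT ⟨T, h⟩) ∘ₗ LinearMap.proj n else 0

theorem extendByZero_apply (eT : {T : Finset U // T.card = t} ≃ Fin L) (w : Fin N → Fin L → F)
    (n : Fin N) (T : Finset U) :
    extendByZero eT w n T = if h : T.card = t then w n (eT ⟨T, h⟩) else 0 := by
  simp only [extendByZero, LinearMap.pi_apply]
  split_ifs <;> rfl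

variable [LinearOrder U] {G : Type} [AddCommGroup G] [Fintype G]

/-- All multicast transmissions, as a function on the sets of virtual users. -/
def multicast (e : Fin K × G ≃ U) (x : G → Fin N → F) (p : Fin K → G) :
    (Fin N → Finset U → F) →ₗ[F] (Finset U → F) :=
  ∑ i, groupCreate e p i ∘ₗ ∑ n, x i n • LinearMap.proj n

theorem multicast_apply (e : Fin K × G ≃ U) (x : G → Fin N → F) (p : Fin K → G)
    (f : Fin N → Finset U → F) :
    multicast e x p f = ∑ i, groupCreate e p i (∑ n, x i n • f n) := by
  simp [multicast]

theorem multicast_apply_eq_zero (e : Fin K × G ≃ U) (x : G → Fin N → F) (p : Fin K → G)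
    {f : Fin N → Finset U → F} (hf : ∀ n T, T.card ≠ t → f n T = 0) {S : Finset U}
    (hS : S.card ≠ t + 1) : multicast e x p f S = 0 := by
  rw [multicast_apply, Finset.sum_apply]
  refine Finset.sum_eq_zero fun i _ => groupCreate_apply_eq_zero e p i (fun T hT => ?_) hS
  simp [Finset.sum_apply, hf _ T hT]

/-- The multicast scheme: the cache of user `j` with mask `g` consists of the subfiles at the sets
that contain the virtual user `(j, g)`, and the data consist of the transmissions at the sets that
contain a virtual user of the first group. -/
theorem exists_linearlyDecodes (hK : 0 < K) {idx : (Fin N → F) → G} {x : G → Fin N → F}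
    (hx : ∀ d, ∃ a : F, d = a • x (idx d)) (t : ℕ) :
    ∃ (Z : Fin K → G → (Fin N → Fin ((K * Fintype.card G).choose t) → F) →ₗ[F]
        (Fin (N * ((K * Fintype.card G).choose t - (K * Fintype.card G - 1).choose t)) → F))
      (X : (Fin K → G) → (Fin N → Fin ((K * Fintype.card G).choose t) → F) →ₗ[F]
        (Fin ((K * Fintype.card G).choose (t + 1) -
          (K * Fintype.card G - Fintype.card G).choose (t + 1)) → F)),
      LinearlyDecodes idx Z X := by
  classical
  let U := Fin (K * Fintype.card G)
  let e : Fin K × G ≃ U := Fintype.equivFinOfCardEq (by simp)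
  let eT : {T : Finset U // T.card = t} ≃ Fin ((K * Fintype.card G).choose t) :=
    Fintype.equivFinOfCardEq (by rw [Fintype.card_finset_len, Fintype.card_fin])
  let eZ : ∀ u : U, Fin N × {T : Finset U // T.card = t ∧ ¬Disjoint T {u}} ≃
      Fin (N * ((K * Fintype.card G).choose t - (K * Fintype.card G - 1).choose t)) :=
    fun u => Fintype.equivFinOfCardEq (by
      rw [Fintype.card_prod, card_subtype_not_disjoint, Fintype.card_fin, Fintype.card_fin,
        Finset.card_singleton])
  -- The leaders: all virtual users of the first group, whether or not its user is active.
  let ℓ : Finset U := Finset.univ.map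
    ⟨fun i : G => e (⟨0, hK⟩, i), fun i k h => by simpa using h⟩
  let eX : {S : Finset U // S.card = t + 1 ∧ ¬Disjoint S ℓ} ≃
      Fin ((K * Fintype.card G).choose (t + 1) -
        (K * Fintype.card G - Fintype.card G).choose (t + 1)) :=
    Fintype.equivFinOfCardEq (by
      rw [card_subtype_not_disjoint, Fintype.card_fin, Finset.card_map, Finset.card_univ])
  refine ⟨fun j g => LinearMap.pi fun i =>
      LinearMap.proj (eT ⟨((eZ (e (j, g))).symm i).2.1, ((eZ (e (j, g))).symm i).2.2.1⟩) ∘ₗ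
        LinearMap.proj ((eZ (e (j, g))).symm i).1,
    fun p => LinearMap.pi fun i =>
      LinearMap.proj (eX.symm i).1 ∘ₗ multicast e x p ∘ₗ extendByZero eT, ?_⟩
  intro j g p d hd w hZ hX
  have hcache : ∀ n (T : Finset U), e (j, g) ∈ T → extendByZero eT w n T = 0 := by
    intro n T hT
    rw [extendByZero_apply]
    split_ifs with h
    · have := congrFun hZ (eZ (e (j, g)) (n, ⟨T, h, by simpa using hT⟩))
      simpa only [LinearMap.pi_apply, LinearMap.comp_apply, LinearMap.proj_apply,
        Equiv.symm_apply_apply, Pi.zero_apply] using this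
    · rfl
  have hsupp : ∀ n (T : Finset U), T.card ≠ t → extendByZero eT w n T = 0 := fun n T hT => by
    rw [extendByZero_apply, dif_neg hT]
  -- The data give this at sets of size `t + 1`; at other sizes the transmissions are zero anyway.
  have hlead : ∀ S, (∃ i, e (⟨0, hK⟩, i) ∈ S) → multicast e x p (extendByZero eT w) S = 0 := by
    rintro S ⟨i, hi⟩
    by_cases hS : S.card = t + 1
    · have hd : ¬Disjoint S ℓ := fun h =>
        Finset.disjoint_left.1 h hi (Finset.mem_map.2 ⟨i, Finset.mem_univ _, rfl⟩)
      have := congrFun hX (eX ⟨S, hS, hd⟩)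
      simpa only [LinearMap.pi_apply, LinearMap.comp_apply, LinearMap.proj_apply,
        Equiv.symm_apply_apply, Pi.zero_apply] using this
    · exact multicast_apply_eq_zero e x p hsupp hS
  rw [multicast_apply] at hlead
  have hY := sum_groupCreate_eq_zero e p ⟨0, hK⟩ _ hlead
  have hw := eq_zero_of_sum_groupCreate_eq_zero e p j g _ hY fun k S hS => by
    simp [Finset.sum_apply, hcache _ S hS]
  -- The user has recovered the combination of its representative `x (idx d)`; its demand is a
  -- scalar multiple of it.
  obtain ⟨a, ha⟩ := hx d
  rw [← hd] at hw
  ext l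
  have hl := congrFun hw (eT.symm l).1
  simp only [Finset.sum_apply, Pi.smul_apply, smul_eq_mul, extendByZero_apply, (eT.symm l).2,
    dif_pos, Subtype.coe_eta, Equiv.apply_symm_apply, Pi.zero_apply] at hl
  rw [ha]
  simp only [Finset.sum_apply, Pi.smul_apply, smul_eq_mul, mul_assoc, ← Finset.mul_sum, hl,
    mul_zero, Pi.zero_apply]

end Multicast

/-! ### Memory sharing -/

section Sharing

variable {F : Type*} [Field F] {K N : ℕ} {G : Type} [AddCommGroup G]

/-- Files of `B` symbols can be delivered with masked demand indices, caches of `c` symbols and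
`r` data symbols. -/
def Realizable (K : ℕ) (idx : (Fin N → F) → G) (B c r : ℕ) : Prop :=
  ∃ (cacheFn : Fin K → G → (Fin N → Fin B → F) → Fin c → F)
    (dataFn : (Fin K → G) → (Fin N → Fin B → F) → Fin r → F), Decodes idx cacheFn dataFn

/-- Sending all files gives the point `(0, N)` and also serves the symbols left over by rounding in
memory sharing. -/
theorem Realizable.uncoded (idx : (Fin N → F) → G) (b : ℕ) : Realizable K idx b 0 (N * b) := by
  refine ⟨fun _ _ _ => Fin.elim0,
    fun _ W i => W (finProdFinEquiv.symm i).1 (finProdFinEquiv.symm i).2, ?_⟩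
  intro j g p d _ W W' _ h
  have hW : W = W' := by
    ext n i
    simpa using congrFun h (finProdFinEquiv (n, i))
  rw [hW]

theorem Realizable.add {idx : (Fin N → F) → G} {B B' c c' r r' : ℕ}
    (h : Realizable K idx B c r) (h' : Realizable K idx B' c' r') :
    Realizable K idx (B + B') (c + c') (r + r') := by
  obtain ⟨Z, X, h⟩ := h
  obtain ⟨Z', X', h'⟩ := h'
  refine ⟨fun j g W => Fin.append (Z j g fun n i => W n (Fin.castAdd B' i))
      (Z' j g fun n i => W n (Fin.natAdd B i)),
    fun p W => Fin.append (X p fun n i => W n (Fin.castAdd B' i))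
      (X' p fun n i => W n (Fin.natAdd B i)), ?_⟩
  intro j g p d hd W W' hZ hX
  obtain ⟨hZ1, hZ2⟩ := eq_of_append_eq hZ
  obtain ⟨hX1, hX2⟩ := eq_of_append_eq hX
  have h1 := h j g p d hd _ _ hZ1 hX1
  have h2 := h' j g p d hd _ _ hZ2 hX2
  ext i
  refine Fin.addCases (fun i => ?_) (fun i => ?_) i
  · simpa [Finset.sum_apply] using congrFun h1 i
  · simpa [Finset.sum_apply] using congrFun h2 i

theorem Realizable.sum {idx : (Fin N → F) → G} {A : Type*} (s : Finset A) {B c r : A → ℕ}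
    (h : ∀ a, Realizable K idx (B a) (c a) (r a)) :
    Realizable K idx (∑ a ∈ s, B a) (∑ a ∈ s, c a) (∑ a ∈ s, r a) := by
  classical
  induction s using Finset.induction_on with
  | empty => simpa using Realizable.uncoded (K := K) idx 0
  | insert a s ha ih =>
    simp only [Finset.sum_insert ha]
    exact (h a).add ih

/-- Since `n < q ^ n`, as many symbols as `A` has elements suffice, a number independent of the file
length. -/
theorem exists_injective_control (F : Type*) [Field F] [Fintype F] (A : Type*) [Finite A] :
    ∃ (s : ℕ) (ctrl : A → Fin s → F), Function.Injective ctrl := by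
  have := Fintype.ofFinite A
  have h : Fintype.card A ≤ Fintype.card (Fin (Fintype.card A) → F) := by
    rw [Fintype.card_fun, Fintype.card_fin]
    exact (Nat.lt_pow_self Fintype.one_lt_card).le
  obtain ⟨f⟩ := Function.Embedding.nonempty_of_card_le h
  exact ⟨_, f, f.injective⟩

theorem Realizable.exists_scheme [Fintype F] [Fintype G] {idx : (Fin N → F) → G} {B c r s : ℕ}
    (h : Realizable K idx B c r) {ctrl : (Fin K → G) → Fin s → F}
    (hctrl : Function.Injective ctrl) (K' : ℕ) :
    ∃ σ : Scheme F K N B, σ.IsPrivateHotplug K' ∧ σ.cacheLen = c ∧ σ.msgLen = r + s := by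
  obtain ⟨Z, X, h⟩ := h
  exact ⟨_, maskedScheme_isPrivateHotplug h hctrl K', rfl, rfl⟩

/-- Points of the memory-load plane with a realization at subpacketization level `L`. -/
def PointRealizable (K : ℕ) (idx : (Fin N → F) → G) (P : ℝ × ℝ) : Prop :=
  ∃ L c r : ℕ, 0 < L ∧ (c : ℝ) = P.1 * L ∧ (r : ℝ) = P.2 * L ∧
    ∀ m, Realizable K idx (L * m) (c * m) (r * m)

/-- Memory sharing: convex combinations of realizable points are realizable for long files, up to a
bounded number of transmitted symbols. -/
theorem exists_realizable_of_mem_convexHull {idx : (Fin N → F) → G} {S : Set (ℝ × ℝ)}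
    (hS : ∀ P ∈ S, PointRealizable K idx P) {P : ℝ × ℝ} (hP : P ∈ convexHull ℝ S) :
    ∃ C : ℝ, ∀ B : ℕ, ∃ c r : ℕ, Realizable K idx B c r ∧ (c : ℝ) ≤ P.1 * B ∧
      (r : ℝ) ≤ P.2 * B + C := by
  obtain ⟨A, _, w, z, hw0, hw1, hz, rfl⟩ := mem_convexHull_iff_exists_fintype.1 hP
  choose L c r hL hc hr hreal using fun a => hS (z a) (hz a)
  -- Rounding each share down to a multiple of `L a` leaves at most `∑ a, L a` symbols per file,
  -- sent uncoded and uncached.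
  refine ⟨N * ∑ a, (L a : ℝ), fun B => ?_⟩
  let m : A → ℕ := fun a => ⌊w a * B / L a⌋₊
  have hLpos : ∀ a, (0 : ℝ) < L a := fun a => by exact_mod_cast hL a
  have hm_le : ∀ a, (L a : ℝ) * m a ≤ w a * B := fun a => by
    have h : (m a : ℝ) ≤ w a * B / L a :=
      Nat.floor_le (div_nonneg (mul_nonneg (hw0 a) B.cast_nonneg) (hLpos a).le)
    rwa [le_div_iff₀ (hLpos a), mul_comm] at h
  have hm_ge : ∀ a, w a * B - L a ≤ L a * m a := fun a => by
    have h : w a * B / L a < m a + 1 := Nat.lt_floor_add_one _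
    rw [div_lt_iff₀ (hLpos a)] at h
    linarith
  have hwB : ∑ a, w a * (B : ℝ) = B := by rw [← Finset.sum_mul, hw1, one_mul]
  have htot : ∑ a, L a * m a ≤ B := by
    have : ∑ a, (L a : ℝ) * m a ≤ B := hwB ▸ Finset.sum_le_sum fun a _ => hm_le a
    exact_mod_cast this
  have hleft : ((B - ∑ a, L a * m a : ℕ) : ℝ) ≤ ∑ a, (L a : ℝ) := by
    rw [Nat.cast_sub htot]
    push_cast
    have := Finset.sum_le_sum fun a (_ : a ∈ Finset.univ) => hm_ge a
    rw [Finset.sum_sub_distrib, hwB] at this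
    linarith
  have hR := (Realizable.sum Finset.univ fun a => hreal a (m a)).add
    (Realizable.uncoded (K := K) idx (B - ∑ a, L a * m a))
  rw [Nat.add_sub_cancel' htot, add_zero] at hR
  have hle : ∀ {k : ℕ} {q : ℝ} (a : A), (k : ℝ) = q * L a →
      (k : ℝ) * m a ≤ w a * q * B := fun {k q} a hk => by
    have hq : 0 ≤ q := by
      have : 0 ≤ q * L a := hk ▸ k.cast_nonneg
      exact nonneg_of_mul_nonneg_left this (hLpos a)
    calc (k : ℝ) * m a = q * (L a * m a) := by rw [hk]; ring
      _ ≤ q * (w a * B) := mul_le_mul_of_nonneg_left (hm_le a) hq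
      _ = w a * q * B := by ring
  refine ⟨_, _, hR, ?_, ?_⟩
  · push_cast
    rw [Prod.fst_sum, Finset.sum_mul]
    exact Finset.sum_le_sum fun a _ => hle a (hc a)
  · push_cast
    rw [Prod.snd_sum, Finset.sum_mul]
    exact add_le_add (Finset.sum_le_sum fun a _ => hle a (hr a))
      (mul_le_mul_of_nonneg_left hleft N.cast_nonneg)

/-- Half of `ε` pays for approaching the infimum, the other half for the rounding loss and the
control symbols once `B` is large. -/
theorem achievable_of_mem_convexHull [Fintype F] [Fintype G] {idx : (Fin N → F) → G}
    {S : Set (ℝ × ℝ)} (hS : ∀ P ∈ S, PointRealizable K idx P) (K' : ℕ) {M : ℝ}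
    (hM : ∃ y, (M, y) ∈ convexHull ℝ S) : Achievable F K K' N M (lowerConvexEnvelope S M) := by
  intro ε hε
  obtain ⟨y, hy, hylt⟩ := exists_lt_of_csInf_lt (s := {y : ℝ | (M, y) ∈ convexHull ℝ S}) hM
    (show sInf {y : ℝ | (M, y) ∈ convexHull ℝ S} < lowerConvexEnvelope S M + ε / 2 by
      rw [lowerConvexEnvelope]
      linarith)
  obtain ⟨C, hC⟩ := exists_realizable_of_mem_convexHull hS hy
  obtain ⟨s, ctrl, hctrl⟩ := exists_injective_control F (Fin K → G)
  filter_upwards [Filter.eventually_ge_atTop ⌈(C + s) / (ε / 2)⌉₊] with B hB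
  have hB' : C + s ≤ ε / 2 * B := by
    have := Nat.ceil_le.1 hB
    rw [div_le_iff₀ (by positivity)] at this
    linarith
  obtain ⟨c, r, hreal, hc, hr⟩ := hC B
  obtain ⟨σ, hσ, hσc, hσr⟩ := hreal.exists_scheme hctrl K'
  refine ⟨σ, hσ, by rwa [hσc], ?_⟩
  rw [hσr]
  push_cast
  have := mul_le_mul_of_nonneg_right hylt.le (Nat.cast_nonneg (α := ℝ) B)
  simp only at hr
  linarith

end Sharing

/-! ### The demand indices -/

theorem card_projectivization_eq_Ntilde (F : Type*) [Field F] [Fintype F] (N : ℕ) :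
    Nat.card (Projectivization F (Fin N → F)) = Ntilde (Fintype.card F) N := by
  rw [Projectivization.card'', Ntilde]
  simp

theorem Ntilde_pos {q N : ℕ} (hq : 1 < q) (hN : 0 < N) : 0 < Ntilde q N :=
  Nat.div_pos (Nat.sub_le_sub_right (Nat.le_self_pow hN.ne' q) 1) (by omega)

/-- Every vector is a multiple of one of `Ntilde` vectors. -/
theorem exists_index (F : Type*) [Field F] [Fintype F] (N : ℕ)
    [NeZero (Ntilde (Fintype.card F) N)] :
    ∃ (idx : (Fin N → F) → ZMod (Ntilde (Fintype.card F) N))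
      (x : ZMod (Ntilde (Fintype.card F) N) → Fin N → F), ∀ d, ∃ a : F, d = a • x (idx d) := by
  classical
  have hc : Nat.card (Projectivization F (Fin N → F)) =
      Nat.card (ZMod (Ntilde (Fintype.card F) N)) := by
    rw [card_projectivization_eq_Ntilde, Nat.card_zmod]
  obtain ⟨e⟩ : Nonempty (Projectivization F (Fin N → F) ≃ ZMod (Ntilde (Fintype.card F) N)) :=
    Finite.card_eq.1 hc
  -- The zero demand has no projective point; any index serves, with multiplier zero.
  refine ⟨fun d => if h : d ≠ 0 then e (Projectivization.mk F d h) else 0,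
    fun i => (e.symm i).rep, fun d => ?_⟩
  by_cases h : d = 0
  · exact ⟨0, by simp [h]⟩
  · obtain ⟨a, ha⟩ := Projectivization.exists_smul_eq_mk_rep F d h
    refine ⟨((a⁻¹ : Fˣ) : F), ?_⟩
    simp only [ne_eq, h, not_false_eq_true, dif_pos, Equiv.symm_apply_apply, ← ha]
    change d = a⁻¹ • a • d
    rw [inv_smul_smul]

theorem memBL_mul_choose {q K N t : ℕ} (hK : 0 < K) (hq : 0 < Ntilde q N) :
    ((N * ((K * Ntilde q N).choose t - (K * Ntilde q N - 1).choose t) : ℕ) : ℝ) =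
      memBL q K N t * (K * Ntilde q N).choose t := by
  have h :
      ((K * Ntilde q N * ((K * Ntilde q N).choose t - (K * Ntilde q N - 1).choose t) : ℕ) : ℝ) =
      (t * (K * Ntilde q N).choose t : ℕ) :=
    congrArg _ (mul_choose_sub_choose _ t (Nat.mul_pos hK hq))
  have hK' : (K : ℝ) ≠ 0 := by exact_mod_cast hK.ne'
  have hq' : (Ntilde q N : ℝ) ≠ 0 := by exact_mod_cast hq.ne'
  rw [memBL, div_mul_eq_mul_div, eq_div_iff (mul_ne_zero hq' hK')]
  rw [Nat.cast_mul, Nat.cast_mul K, Nat.cast_mul t] at h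
  rw [Nat.cast_mul]
  linear_combination (N : ℝ) * h

theorem loadBL_mul_choose {q K N t : ℕ} (ht : t ≤ K * Ntilde q N) :
    (((K * Ntilde q N).choose (t + 1) - (K * Ntilde q N - Ntilde q N).choose (t + 1) : ℕ) : ℝ) =
      loadBL q K N t * (K * Ntilde q N).choose t := by
  have h : ((K * Ntilde q N).choose t : ℝ) ≠ 0 := by exact_mod_cast (Nat.choose_pos ht).ne'
  rw [loadBL, div_mul_cancel₀ _ h, Nat.cast_sub (Nat.choose_le_choose _ (Nat.sub_le _ _))]

/-- The points with `t = K * Ntilde q N` and `(0, N)` have abscissae `N` and `0`, so their segment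
lies over all of `[0, N]`. This keeps the infimum in the envelope from being over an empty set. -/
theorem exists_mem_convexHull_pointsBL {q K N : ℕ} (hK : 0 < K) (hq : 0 < Ntilde q N) {M : ℝ}
    (hM : M ∈ Set.Icc (0 : ℝ) N) : ∃ y, (M, y) ∈ convexHull ℝ (pointsBL q K N) := by
  have hK' : (K : ℝ) ≠ 0 := by exact_mod_cast hK.ne'
  have hq' : (Ntilde q N : ℝ) ≠ 0 := by exact_mod_cast hq.ne'
  have h0 : (0, (N : ℝ)) ∈ pointsBL q K N := Set.mem_insert _ _
  have h1 : ((N : ℝ), loadBL q K N (K * Ntilde q N)) ∈ pointsBL q K N := by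
    refine Set.mem_insert_of_mem _ ⟨K * Ntilde q N, le_rfl, Prod.ext ?_ rfl⟩
    rw [memBL]
    push_cast
    field_simp
  have hsub := segment_subset_convexHull (𝕜 := ℝ) h0 h1
  have hMseg : M ∈ segment ℝ (0 : ℝ) N := by rwa [segment_eq_Icc N.cast_nonneg]
  obtain ⟨a, b, ha, hb, hab, rfl⟩ := hMseg
  exact ⟨_, hsub ⟨a, b, ha, hb, hab, rfl⟩⟩

end

end Hotplug

/-! ### Both claims from the multicast scheme. -/

theorem theorem1 {F : Type*} [Field F] [Fintype F] (K K' N : ℕ)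
    (hK : 0 < K) (hK' : K' ≤ K) (hN : 0 < N) :
    (∀ M ∈ Set.Icc (0 : ℝ) N, Hotplug.Achievable F K K' N M
      (Hotplug.lowerConvexEnvelope (Hotplug.pointsBL (Fintype.card F) K N) M)) ∧
    (∀ t : ℕ, t ≤ K * Hotplug.Ntilde (Fintype.card F) N →
      Hotplug.AttainedWithLevel F K K' N
        (Hotplug.memBL (Fintype.card F) K N t) (Hotplug.loadBL (Fintype.card F) K N t)
        ((K * Hotplug.Ntilde (Fintype.card F) N).choose t)) := by
  have hq := Hotplug.Ntilde_pos (Fintype.one_lt_card (α := F)) hN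
  have : NeZero (Hotplug.Ntilde (Fintype.card F) N) := ⟨hq.ne'⟩
  obtain ⟨idx, x, hx⟩ := Hotplug.exists_index F N
  have hlin := Hotplug.exists_linearlyDecodes hK hx
  rw [ZMod.card] at hlin
  constructor
  · intro M hM
    refine Hotplug.achievable_of_mem_convexHull (idx := idx) ?_ K'
      (Hotplug.exists_mem_convexHull_pointsBL hK hq hM)
    rintro P (rfl | ⟨t, ht, rfl⟩)
    · refine ⟨1, 0, N, one_pos, by simp, by simp, fun m => ?_⟩
      rw [one_mul, zero_mul]
      exact Hotplug.Realizable.uncoded idx m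
    · obtain ⟨Z, X, h⟩ := hlin t
      exact ⟨_, _, _, Nat.choose_pos ht, Hotplug.memBL_mul_choose hK hq,
        Hotplug.loadBL_mul_choose ht, fun m => ⟨_, _, h.decodes m⟩⟩
  · intro t ht
    obtain ⟨Z, X, h⟩ := hlin t
    obtain ⟨s, ctrl, hctrl⟩ := Hotplug.exists_injective_control F
      (Fin K → ZMod (Hotplug.Ntilde (Fintype.card F) N))
    exact ⟨Hotplug.linearPacketScheme idx Z X ctrl,
      fun m _ => Hotplug.linearPacketScheme_isPrivateHotplug h hctrl m K',
      Hotplug.memBL_mul_choose hK hq, Hotplug.loadBL_mul_choose ht⟩
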